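/- Let $d\ge 1$, let $\Omega\subset\mathbb R^d$ be a bounded open set with boundary $\partial\Omega$, and let $\theta\in\mathbb R^d$ with $|\theta|=1$. Notation. $W_\theta(\Omega)$ is the space of all $u\in L^2(\Omega)$ which have a weak derivative $\partial_\theta u\in L^2(\Omega)$ in the direction $\theta$, i.e. $\int_\Omega u\,(\theta\cdot\nabla\varphi)\,dx=-\int_\Omega(\partial_\theta u)\,\varphi\,dx$ for all $\varphi\in C_c^\infty(\Omega)$; its norm is $\|u\|_\theta=\big(\|u\|_{L^2(\Omega)}^2+\|\partial_\theta u\|_{L^2(\Omega)}^2\big)^{1/2}$. For $x\in\Omega$, $\Phi_\theta(x)=x+\delta_\theta(x)\theta\in\partial\Omega$ with $\delta_\theta(x)=\sup\{s\ge0:\ x+t\theta\in\Omega\ \forall t\in[0,s)\}$, and $\mu_\theta$ is the finite Borel measure on $\partial\Omega$ given by $\mu_\theta(A)=\lambda^d(\{x\in\Omega:\Phi_\theta(x)\in A\})$. Let $H_\theta$ be the hyperplane orthogonal to $\theta$, $\mathcal P_\theta$ the orthogonal projection on $H_\theta$, and for $y\in H_\theta$ let $\omega_\theta(y)=\{s\in\mathbb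 R: s\theta+y\in\Omega\}$. A function $g:\partial\Omega\to\mathbb R$ is a directional trace of $u\in W_\theta(\Omega)$ in the direction $\theta$ if there are a representative of $u$ (again denoted $u$) and a set $A\subset\mathcal P_\theta(\Omega)$ such that $\mathcal P_\theta(\Omega)\setminus A$ is $\lambda^{d-1}$-negligible and, for all $y\in A$, the function $u_{\theta,y}:s\mapsto u(s\theta+y)$ belongs to $H^1(\omega_\theta(y))$ and, for each connected component $(\alpha,\beta)$ of $\omega_\theta(y)$, $u_{\theta,y}$ restricted to $(\alpha,\beta)$ has a representative $f$ continuous on $(\alpha,\beta]$ with $g(\beta\theta+y)=f(\beta)$. The directional trace $\gamma_\theta u$ is the set of all directional traces of $u$ in the direction $\theta$. Proposition. Let $u\in W_\theta(\Omega)$. Then $\gamma_\theta u\in L^2(\partial\Omega,\mu_\theta)$, that is, $\gamma_\theta u$ is exactly one class, for equality $\mu_\theta$-a.e., of functions on $\partial\Omega$ that are square integrable for $\mu_\theta$, and $$\int_{\partial\Omega}(\gamma_\theta u)^2\,d\mu_\theta\le 2\max\big(1,\operatorname{diam}(\Omega)^2\big)\,\|u\|_\theta^2 .$$ Moreover, if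 $\gamma_\theta u=0$ $\mu_\theta$-a.e. on $\partial\Omega$, then $$\|u\|_{L^2(\Omega)}\le\operatorname{diam}(\Omega)\,\|\partial_\theta u\|_{L^2(\Omega)} .$$ -/

import Mathlib

open MeasureTheory Set Filter Topology
open scoped ContDiff ENNReal

namespace DirTrace

/-- `f'` is a weak derivative of `f` in the direction `e` on the open set `U`: for every test
function `φ ∈ C_c^∞(U)`, `∫_U f ∂_e φ = - ∫_U f' φ`, where `∂_e φ (x) = Dφ(x) e`. -/
def HasWeakDirDeriv {V : Type*} [NormedAddCommGroup V] [NormedSpace ℝ V] [MeasureSpace V]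
    (U : Set V) (e : V) (f f' : V → ℝ) : Prop :=
  ∀ φ : V → ℝ, ContDiff ℝ ∞ φ → HasCompactSupport φ → tsupport φ ⊆ U →
    ∫ x in U, f x * fderiv ℝ φ x e = - ∫ x in U, f' x * φ x

/-- The function `f` (or rather its class) belongs to the Sobolev space `H¹(U)`, `U ⊆ ℝ` open. -/
def MemH1 (U : Set ℝ) (f : ℝ → ℝ) : Prop :=
  MemLp f 2 (volume.restrict U) ∧
    ∃ f' : ℝ → ℝ, MemLp f' 2 (volume.restrict U) ∧ HasWeakDirDeriv U (1 : ℝ) f f'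

section Space

variable {d : ℕ} (Ω : Set (EuclideanSpace ℝ (Fin d))) (θ : EuclideanSpace ℝ (Fin d))

/-- `L²(Ω)`, as a space of classes of functions. -/
abbrev L2 : Type := Lp ℝ 2 ((volume : Measure (EuclideanSpace ℝ (Fin d))).restrict Ω)

/-- `W_θ(Ω)`: the `u ∈ L²(Ω)` which have a weak derivative in the direction `θ` in `L²(Ω)`. -/
def W : Set (L2 Ω) := {u | ∃ v : L2 Ω, HasWeakDirDeriv Ω θ u v}

open Classical in
/-- The weak directional derivative `∂_θ u ∈ L²(Ω)` of `u ∈ W_θ(Ω)` (with the value `0` if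
`u ∉ W_θ(Ω)`). -/
noncomputable def dirDeriv (u : L2 Ω) : L2 Ω :=
  if h : ∃ v : L2 Ω, HasWeakDirDeriv Ω θ u v then h.choose else 0

/-- The norm of `W_θ(Ω)`: `‖u‖_θ = (‖u‖² + ‖∂_θ u‖²)^{1/2}`, with norms of `L²(Ω)`. -/
noncomputable def normW (u : L2 Ω) : ℝ :=
  Real.sqrt (‖u‖ ^ 2 + ‖dirDeriv Ω θ u‖ ^ 2)

/-- `δ_θ(x) = sup {s ≥ 0 : ∀ t ∈ [0,s[, x + t θ ∈ Ω}`. -/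
noncomputable def delta (x : EuclideanSpace ℝ (Fin d)) : ℝ :=
  sSup {s : ℝ | 0 ≤ s ∧ ∀ t ∈ Ico 0 s, x + t • θ ∈ Ω}

/-- `Φ_θ(x) = x + δ_θ(x) θ`: for `x ∈ Ω`, the first point of `∂Ω` seen from `x` in the
direction `θ`. -/
noncomputable def Phi (x : EuclideanSpace ℝ (Fin d)) : EuclideanSpace ℝ (Fin d) :=
  x + delta Ω θ x • θ

/-- The directional measure `μ_θ` on `∂Ω`: `μ_θ(A) = λ({x ∈ Ω : Φ_θ(x) ∈ A})` for every Borel set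
`A` of `∂Ω` (see `dirMeasure_apply`). -/
noncomputable def dirMeasure : Measure (frontier Ω) :=
  (((volume : Measure (EuclideanSpace ℝ (Fin d))).restrict Ω).map (Phi Ω θ)).comap Subtype.val

/-- The hyperplane `H_θ` orthogonal to `θ`; its measure `volume` is the `(d-1)`-dimensional
Lebesgue measure. -/
noncomputable abbrev Hyp : Submodule ℝ (EuclideanSpace ℝ (Fin d)) := (Submodule.span ℝ {θ})ᗮ

/-- `P_θ(Ω) ⊆ H_θ`, the image of `Ω` under the orthogonal projection on `H_θ`. -/
noncomputable def proj : Set (Hyp θ) := (fun x => (Hyp θ).orthogonalProjectionOnto x) '' Ω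

/-- `ω_θ(y) = {s ∈ ℝ : s θ + y ∈ Ω}`. -/
def omega (y : Hyp θ) : Set ℝ :=
  {s | s • θ + (y : EuclideanSpace ℝ (Fin d)) ∈ Ω}

/-- `]α,β[` is one of the disjoint bounded open intervals (the connected components) whose union
is `ω_θ(y)`. -/
def IsChord (y : Hyp θ) (α β : ℝ) : Prop :=
  α < β ∧ Ioo α β ⊆ omega Ω θ y ∧ α ∉ omega Ω θ y ∧ β ∉ omega Ω θ y

/-- `g : ∂Ω → ℝ` is a directional trace of `u` in the direction `θ`. Here `f` is the
representative of the restriction to `]α,β[` of `s ↦ u(s θ + y)` which is continuous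
on `]α,β]`. -/
def IsDirTrace (u : L2 Ω) (g : frontier Ω → ℝ) : Prop :=
  ∃ v : EuclideanSpace ℝ (Fin d) → ℝ, v =ᵐ[volume.restrict Ω] u ∧
    ∃ A : Set (Hyp θ), A ⊆ proj Ω θ ∧ volume (proj Ω θ \ A) = 0 ∧
      ∀ y ∈ A,
        MemH1 (omega Ω θ y) (fun s => v (s • θ + (y : EuclideanSpace ℝ (Fin d)))) ∧
        ∀ α β : ℝ, IsChord Ω θ y α β →
          ∃ f : ℝ → ℝ, ContinuousOn f (Ioc α β) ∧
            (∀ᵐ s ∂(volume.restrict (Ioo α β)),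
              f s = v (s • θ + (y : EuclideanSpace ℝ (Fin d)))) ∧
            ∃ hz : β • θ + (y : EuclideanSpace ℝ (Fin d)) ∈ frontier Ω, g ⟨_, hz⟩ = f β

/-- The directional trace `γ_θ u`: the set of all directional traces of `u` in the direction
`θ`. -/
def dirTrace (u : L2 Ω) : Set (frontier Ω → ℝ) := {g | IsDirTrace Ω θ u g}

end Space

section Facts

variable {d : ℕ} {Ω : Set (EuclideanSpace ℝ (Fin d))} {θ : EuclideanSpace ℝ (Fin d)}

theorem delta_bddAbove (hb : Bornology.IsBounded Ω) (hθ : ‖θ‖ = 1)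
    (x : EuclideanSpace ℝ (Fin d)) :
    BddAbove {s : ℝ | 0 ≤ s ∧ ∀ t ∈ Ico 0 s, x + t • θ ∈ Ω} := by
  refine ⟨Metric.diam Ω, ?_⟩
  rintro s ⟨hs0, hs⟩
  refine le_of_forall_lt fun c hc => ?_
  rcases lt_or_ge c 0 with h | h
  · exact h.trans_le Metric.diam_nonneg
  obtain ⟨t, hct, hts⟩ := exists_between hc
  have h0 : x + (0 : ℝ) • θ ∈ Ω := hs 0 ⟨le_rfl, h.trans_lt hc⟩
  have h1 := Metric.dist_le_diam_of_mem hb (hs t ⟨h.trans hct.le, hts⟩) h0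
  have h2 : dist (x + t • θ) (x + (0 : ℝ) • θ) = t := by
    rw [dist_add_left, zero_smul, dist_zero_right, norm_smul, hθ, mul_one,
      Real.norm_of_nonneg (h.trans hct.le)]
  linarith

theorem lt_delta_iff (ho : IsOpen Ω) (hb : Bornology.IsBounded Ω) (hθ : ‖θ‖ = 1)
    (x : EuclideanSpace ℝ (Fin d)) {c : ℝ} (hc : 0 ≤ c) :
    c < delta Ω θ x ↔ ∀ t ∈ Icc 0 c, x + t • θ ∈ Ω := by
  constructor
  · intro h t ht
    obtain ⟨s, ⟨_, hs⟩, hcs⟩ := exists_lt_of_lt_csSup (s := {s : ℝ | 0 ≤ s ∧ ∀ t ∈ Ico 0 s, x + t • θ ∈ Ω})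
      ⟨0, le_rfl, by simp⟩ h
    exact hs t ⟨ht.1, ht.2.trans_lt hcs⟩
  · intro h
    have hcont : Continuous fun t : ℝ => x + t • θ := by fun_prop
    obtain ⟨ε, hε, hball⟩ := Metric.isOpen_iff.1 (ho.preimage hcont) c (h c ⟨hc, le_rfl⟩)
    refine lt_of_lt_of_le (lt_add_of_pos_right c hε)
      (le_csSup (delta_bddAbove hb hθ x) ⟨by positivity, fun t ht => ?_⟩)
    rcases le_or_gt t c with h1 | h1
    · exact h t ⟨ht.1, h1⟩
    · refine hball ?_
      rw [Metric.mem_ball, Real.dist_eq, abs_of_pos (sub_pos.2 h1)]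
      linarith [ht.2]

theorem measurable_Phi (ho : IsOpen Ω) (hb : Bornology.IsBounded Ω) (hθ : ‖θ‖ = 1) :
    Measurable (Phi Ω θ) := by
  have hδ : Measurable (delta Ω θ) := by
    refine measurable_of_Ioi fun c => ?_
    rcases lt_or_ge c 0 with h | h
    · have : delta Ω θ ⁻¹' Ioi c = univ := by
        refine eq_univ_of_forall fun x => h.trans_le ?_
        exact le_csSup (delta_bddAbove hb hθ x) ⟨le_rfl, by simp⟩
      rw [this]; exact MeasurableSet.univ
    · have : delta Ω θ ⁻¹' Ioi c = {x | ∀ t ∈ Icc 0 c, x + t • θ ∈ Ω} := by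
        ext x; exact lt_delta_iff ho hb hθ x h
      rw [this]
      refine IsOpen.measurableSet (isOpen_iff_mem_nhds.2 fun x hx => ?_)
      refine isCompact_Icc.eventually_forall_of_forall_eventually fun t ht => ?_
      have hcont : Continuous fun p : EuclideanSpace ℝ (Fin d) × ℝ => p.1 + p.2 • θ := by
        fun_prop
      exact hcont.continuousAt.eventually (ho.mem_nhds (hx t ht))
  exact measurable_id.add (hδ.smul_const θ)

/-- `Φ_θ` maps `Ω` into `∂Ω`. -/
theorem Phi_mem_frontier (ho : IsOpen Ω) (hb : Bornology.IsBounded Ω) (hθ : ‖θ‖ = 1)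
    {x : EuclideanSpace ℝ (Fin d)} (hx : x ∈ Ω) : Phi Ω θ x ∈ frontier Ω := by
  have hpos : 0 < delta Ω θ x := by
    rw [lt_delta_iff ho hb hθ x le_rfl]
    intro t ht
    have : t = 0 := le_antisymm ht.2 ht.1
    simpa [this] using hx
  have hmem : ∀ t ∈ Ico 0 (delta Ω θ x), x + t • θ ∈ Ω := fun t ht =>
    (lt_delta_iff ho hb hθ x ht.1).1 ht.2 t ⟨ht.1, le_rfl⟩
  rw [ho.frontier_eq]
  refine ⟨?_, fun hin => ?_⟩
  · have hcont : Continuous fun t : ℝ => x + t • θ := by fun_prop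
    have h1 : delta Ω θ x ∈ closure (Ico 0 (delta Ω θ x)) := by
      rw [closure_Ico hpos.ne]; exact ⟨hpos.le, le_rfl⟩
    exact map_mem_closure (f := fun t : ℝ => x + t • θ) hcont h1 hmem
  · refine lt_irrefl (delta Ω θ x) ((lt_delta_iff ho hb hθ x hpos.le).2 fun t ht => ?_)
    rcases ht.2.lt_or_eq with h | h
    · exact hmem t ⟨ht.1, h⟩
    · rw [h]; exact hin

theorem dirMeasure_apply (ho : IsOpen Ω) (hb : Bornology.IsBounded Ω) (hθ : ‖θ‖ = 1)
    {A : Set (frontier Ω)} (hA : MeasurableSet A) :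
    dirMeasure Ω θ A = volume (Ω ∩ {x | ∃ z ∈ A, (z : EuclideanSpace ℝ (Fin d)) = Phi Ω θ x}) := by
  have hF : MeasurableSet (frontier Ω) := isClosed_frontier.measurableSet
  rw [dirMeasure, (MeasurableEmbedding.subtype_coe hF).comap_apply,
    Measure.map_apply (measurable_Phi ho hb hθ) (hF.subtype_image hA),
    Measure.restrict_apply' ho.measurableSet, inter_comm]
  rfl

end Facts

end DirTrace

/-!
Averaging test functions over segments of direction `θ` shows that `v` is a weak derivative of `u`
if and only if `u (x + t θ) - u x = ∫₀ᵗ v (x + r θ) dr` for almost every `x` whose segment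
`[x, x + t θ]` lies in `Ω`. Hence, on almost every chord of direction `θ`, `u` is a primitive of
`∂_θ u`, and `u x = e (Φ_θ x) - I x`, where `I x` is the integral of `∂_θ u` from `x` to the exit
point `Φ_θ x` and `e z` is the limit of the averages of `u` over segments shrinking to their end
point `z`. By Cauchy–Schwarz on each chord and Fubini, `‖I‖ ≤ diam Ω * ‖∂_θ u‖`. Since `μ_θ` is the
image of Lebesgue measure under `Φ_θ`, this bounds `e` in `L²(μ_θ)`, and it bounds `u` when `e = 0`.

A property of points of `∂Ω` holds `μ_θ`-a.e. if and only if, on almost every line of direction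
`θ`, it holds at the right end of every chord; therefore the directional traces are exactly the
functions which are equal to `e` `μ_θ`-a.e.
-/

namespace DirTrace

section Translation

variable {E : Type*} [NormedAddCommGroup E] [NormedSpace ℝ E] [SecondCountableTopology E]
  [MeasurableSpace E] [BorelSpace E] {μ : Measure E} [SFinite μ] [μ.IsAddRightInvariant]
  {F : Type*} [NormedAddCommGroup F]

theorem quasiMeasurePreserving_add_smul (μ : Measure E) [SFinite μ] [μ.IsAddRightInvariant]
    (θ : E) (ν : Measure ℝ) [SFinite ν] :
    Measure.QuasiMeasurePreserving (fun p : E × ℝ => p.1 + p.2 • θ) (μ.prod ν) μ :=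
  QuasiMeasurePreserving.prod_of_left (by fun_prop) <| .of_forall fun r =>
    (measurePreserving_add_right μ (r • θ)).quasiMeasurePreserving

theorem integrable_comp_add_smul {f : E → F} (hf : Integrable f μ) (θ : E)
    (ν : Measure ℝ) [IsFiniteMeasure ν] :
    Integrable (fun p : E × ℝ => f (p.1 + p.2 • θ)) (μ.prod ν) := by
  refine (integrable_prod_iff' (hf.1.comp_quasiMeasurePreserving
    (quasiMeasurePreserving_add_smul μ θ ν))).2
    ⟨.of_forall fun r => hf.comp_add_right (r • θ), ?_⟩
  simp_rw [Function.comp_apply, integral_add_right_eq_self fun x => ‖f x‖]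
  exact integrable_const _

theorem ae_intervalIntegrable_comp_add_smul {f : E → F} (hf : Integrable f μ) (θ : E) :
    ∀ᵐ x ∂μ, ∀ a b : ℝ, IntervalIntegrable (fun r : ℝ => f (x + r • θ)) volume a b := by
  have integrableOn_Ioc : ∀ n : ℕ, ∀ᵐ x ∂μ,
      IntegrableOn (fun r : ℝ => f (x + r • θ)) (Ioc (-(n : ℝ)) n) := fun n =>
    (integrable_comp_add_smul hf θ (volume.restrict (Ioc (-(n : ℝ)) n))).prod_right_ae
  filter_upwards [ae_all_iff.2 integrableOn_Ioc] with x hx a b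
  obtain ⟨n, hn⟩ := exists_nat_ge (max |a| |b|)
  have ha := abs_le.1 ((le_max_left _ _).trans hn)
  have hb := abs_le.1 ((le_max_right _ _).trans hn)
  exact intervalIntegrable_iff.2 <| (hx n).mono_set <|
    Ioc_subset_Ioc (le_min ha.1 hb.1) (max_le ha.2 hb.2)

variable [NormedSpace ℝ F]

theorem integrable_intervalIntegral_comp_add_smul {f : E → F} (hf : Integrable f μ) (θ : E)
    {a b : ℝ} (hab : a ≤ b) : Integrable (fun x => ∫ r in a..b, f (x + r • θ)) μ := by
  simp_rw [intervalIntegral.integral_of_le hab]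
  exact (integrable_comp_add_smul hf θ (volume.restrict (Ioc a b))).integral_prod_left

theorem integral_intervalIntegral_comp_add_smul [CompleteSpace F] {f : E → F}
    (hf : Integrable f μ) (θ : E) {a b : ℝ} (hab : a ≤ b) :
    ∫ x, (∫ r in a..b, f (x + r • θ)) ∂μ = (b - a) • ∫ x, f x ∂μ := by
  have swap := intervalIntegral_integral_swap (μ := μ) (a := a) (b := b)
    (f := fun r x => f (x + r • θ))
    (by rw [uIoc_of_le hab]; exact (integrable_comp_add_smul hf θ _).swap)
  simp_rw [← swap, integral_add_right_eq_self f, intervalIntegral.integral_const]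

theorem stronglyMeasurable_intervalIntegral_comp_add_smul {f : E → F} (hf : StronglyMeasurable f)
    (θ : E) : StronglyMeasurable fun p : E × ℝ => ∫ r in (0 : ℝ)..p.2, f (p.1 + r • θ) := by
  have rescale (p : E × ℝ) : ∫ r in (0 : ℝ)..p.2, f (p.1 + r • θ) =
      p.2 • ∫ s in Ioc (0 : ℝ) 1, f (p.1 + (s * p.2) • θ) := by
    simpa [intervalIntegral.integral_of_le] using
      (intervalIntegral.smul_integral_comp_mul_right (a := 0) (b := 1)
        (fun r => f (p.1 + r • θ)) p.2).symm
  have integrand : StronglyMeasurable fun q : (E × ℝ) × ℝ => f (q.1.1 + (q.2 * q.1.2) • θ) :=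
    hf.comp_measurable (by fun_prop)
  simp_rw [rescale]
  exact measurable_snd.stronglyMeasurable.smul integrand.integral_prod_right'

end Translation

section SegmentAverage

variable {E : Type*} [NormedAddCommGroup E] [NormedSpace ℝ E]

/-- The average of `φ` over the segment `[x - e, x]`. For a test function `φ` this is again a
test function, whose derivative in the direction `e` is `x ↦ φ x - φ (x - e)`. -/
noncomputable def segmentAverage (φ : E → ℝ) (e x : E) : ℝ :=
  ∫ s in (0 : ℝ)..1, φ (x - s • e)

variable {φ : E → ℝ}

theorem abs_segmentAverage_le {C : ℝ} (hC : ∀ x, ‖φ x‖ ≤ C) (e x : E) :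
    |segmentAverage φ e x| ≤ C := by
  simpa [segmentAverage] using intervalIntegral.norm_integral_le_of_norm_le_const
    (f := fun s : ℝ => φ (x - s • e)) (a := 0) (b := 1) fun s _ => hC (x - s • e)

theorem tendsto_segmentAverage (hφ : Continuous φ) (θ x : E) :
    Tendsto (fun t : ℝ => segmentAverage φ (t • θ) x) (𝓝 0) (𝓝 (φ x)) := by
  have cont : Continuous fun t : ℝ => segmentAverage φ (t • θ) x :=
    intervalIntegral.continuous_parametric_intervalIntegral_of_continuous'
      (f := fun t s : ℝ => φ (x - s • t • θ)) (by fun_prop) 0 1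
  simpa [segmentAverage] using cont.tendsto 0

theorem hasLineDerivAt_segmentAverage (hφ : Continuous φ) (e x : E) :
    HasLineDerivAt ℝ (segmentAverage φ e) (φ x - φ (x - e)) x e := by
  have hG : Continuous fun r : ℝ => φ (x + r • e) := by fun_prop
  have reparam : ∀ h : ℝ, segmentAverage φ e (x + h • e) =
      (∫ r in (0 : ℝ)..h, φ (x + r • e)) - ∫ r in (0 : ℝ)..h - 1, φ (x + r • e) := fun h => by
    rw [intervalIntegral.integral_interval_sub_left (hG.intervalIntegrable _ _)
      (hG.intervalIntegrable _ _)]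
    simpa [segmentAverage, sub_smul, add_sub_assoc] using
      intervalIntegral.integral_comp_sub_left (fun r : ℝ => φ (x + r • e)) h (a := 0) (b := 1)
  have primitive (b : ℝ) := (hG.integral_hasStrictDerivAt 0 b).hasDerivAt
  refine HasDerivAt.congr_of_eventuallyEq (f := fun h : ℝ => _) ?_ (.of_forall reparam)
  exact ((primitive 0).sub ((primitive (0 - 1)).comp_sub_const 0 1)).congr_deriv
    (by simp [sub_eq_add_neg])

theorem support_segmentAverage_subset (φ : E → ℝ) (e : E) :
    Function.support (segmentAverage φ e) ⊆
      (fun p : E × ℝ => p.1 + p.2 • e) '' (tsupport φ ×ˢ Icc 0 1) := by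
  intro x
  contrapose!
  intro hx
  refine Function.notMem_support.2 ?_
  refine intervalIntegral.integral_zero_ae (.of_forall fun s hs => ?_)
  rw [uIoc_of_le zero_le_one] at hs
  by_contra hne
  exact hx ⟨(x - s • e, s), ⟨subset_tsupport _ hne, hs.1.le, hs.2⟩, by simp⟩

theorem tsupport_segmentAverage_subset (hc : HasCompactSupport φ) (e : E) :
    tsupport (segmentAverage φ e) ⊆
      (fun p : E × ℝ => p.1 + p.2 • e) '' (tsupport φ ×ˢ Icc 0 1) :=
  closure_minimal (support_segmentAverage_subset φ e)
    ((hc.isCompact.prod isCompact_Icc).image (by fun_prop)).isClosed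

theorem hasCompactSupport_segmentAverage (hc : HasCompactSupport φ) (e : E) :
    HasCompactSupport (segmentAverage φ e) :=
  ((hc.isCompact.prod isCompact_Icc).image (by fun_prop)).of_isClosed_subset
    (isClosed_tsupport _) (tsupport_segmentAverage_subset hc e)

theorem contDiff_segmentAverage (hφ : ContDiff ℝ ∞ φ) (hc : HasCompactSupport φ) (e : E) :
    ContDiff ℝ ∞ (segmentAverage φ e) := by
  borelize E
  have hm : Measurable fun s : ℝ => s • e :=
    (by fun_prop : Continuous fun s : ℝ => s • e).measurable
  -- The average is the convolution of `φ` with the pushforward of Lebesgue measure on `(0, 1]`.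
  let ν : Measure E := (volume.restrict (Ioc (0 : ℝ) 1)).map fun s => s • e
  have : IsFiniteMeasure ν := Measure.isFiniteMeasure_map _ _
  have eq_convolution : segmentAverage φ e =
      convolution (fun _ => (1 : ℝ)) φ (ContinuousLinearMap.mul ℝ ℝ) ν := by
    ext x
    have hφx : StronglyMeasurable fun y => φ (x - y) :=
      (hφ.continuous.comp (continuous_sub_left x)).stronglyMeasurable_of_hasCompactSupport
        (hc.comp_homeomorph (Homeomorph.subLeft x))
    rw [convolution_def, integral_map hm.aemeasurable (by simpa using hφx.aestronglyMeasurable)]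
    simp [segmentAverage, intervalIntegral.integral_of_le]
  rw [eq_convolution]
  exact hc.contDiff_convolution_right (n := ⊤) _ (integrable_const (1 : ℝ)).locallyIntegrable hφ

end SegmentAverage

section WeakDerivative

variable {E : Type*} [NormedAddCommGroup E] [NormedSpace ℝ E]

theorem hasWeakDirDeriv_iff [MeasureSpace E] {Ω : Set E} {θ : E} {f f' : E → ℝ} :
    HasWeakDirDeriv Ω θ f f' ↔
      ∀ φ : E → ℝ, ContDiff ℝ ∞ φ → HasCompactSupport φ → tsupport φ ⊆ Ω →
        ∫ x, f x * fderiv ℝ φ x θ = -∫ x, f' x * φ x := by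
  refine forall_congr' fun φ => forall₃_congr fun _ _ hΩ => ?_
  have notMem_tsupport {x : E} (hx : x ∉ Ω) : x ∉ tsupport φ := fun h => hx (hΩ h)
  rw [setIntegral_eq_integral_of_forall_compl_eq_zero fun x hx => by
      simp [fderiv_of_notMem_tsupport ℝ (notMem_tsupport hx)],
    setIntegral_eq_integral_of_forall_compl_eq_zero fun x hx => by
      simp [image_eq_zero_of_notMem_tsupport (notMem_tsupport hx)]]

theorem isOpen_setOf_forall_add_smul_mem {Ω : Set E} (hΩ : IsOpen Ω) (θ : E) {I : Set ℝ}
    (hI : IsCompact I) : IsOpen {x | ∀ s ∈ I, x + s • θ ∈ Ω} := by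
  refine isOpen_iff_mem_nhds.2 fun x hx =>
    hI.eventually_forall_of_forall_eventually fun s hs => ?_
  have hcont : Continuous fun p : E × ℝ => p.1 + p.2 • θ := by fun_prop
  exact hcont.continuousAt.eventually (hΩ.mem_nhds (hx s hs))

theorem eventually_forall_add_smul_mem {K Ω : Set E} (hK : IsCompact K)
    (hΩ : IsOpen Ω) (hKΩ : K ⊆ Ω) (θ : E) :
    ∀ᶠ t in 𝓝[>] (0 : ℝ), ∀ x ∈ K, ∀ s ∈ Icc 0 t, x + s • θ ∈ Ω := by
  have near_zero : ∀ᶠ s in 𝓝 (0 : ℝ), ∀ x ∈ K, x + s • θ ∈ Ω := by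
    refine hK.eventually_forall_of_forall_eventually fun x hx => ?_
    have hcont : Continuous fun p : ℝ × E => p.2 + p.1 • θ := by fun_prop
    exact hcont.continuousAt.eventually (hΩ.mem_nhds (by simpa using hKΩ hx))
  obtain ⟨ε, hε, hball⟩ := Metric.eventually_nhds_iff.1 near_zero
  filter_upwards [Ioo_mem_nhdsGT hε] with t ht x hx s hs
  exact hball (by simpa [abs_of_nonneg hs.1] using hs.2.trans_lt ht.2) x hx

theorem integral_mul_add_sub {G : Type*} [AddGroup G] [MeasurableSpace G] [MeasurableAdd G]
    {μ : Measure G} [μ.IsAddRightInvariant] {U φ : G → ℝ} {C : ℝ} (hU : Integrable U μ)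
    (hφ : Measurable φ) (hC : ∀ x, ‖φ x‖ ≤ C) (e : G) :
    ∫ x, φ x * (U (x + e) - U x) ∂μ = -∫ x, U x * (φ x - φ (x - e)) ∂μ := by
  have integrable_left : Integrable (fun x => φ x * U (x + e)) μ :=
    (hU.comp_add_right e).bdd_mul hφ.aestronglyMeasurable (.of_forall hC)
  have integrable_right : Integrable (fun x => φ (x - e) * U x) μ := by
    simpa [sub_eq_add_neg] using integrable_left.comp_add_right (-e)
  have integrable_mul : Integrable (fun x => φ x * U x) μ :=
    hU.bdd_mul hφ.aestronglyMeasurable (.of_forall hC)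
  have shift : ∫ x, φ (x - e) * U x ∂μ = ∫ x, φ x * U (x + e) ∂μ := by
    simpa using (integral_add_right_eq_self (fun x => φ (x - e) * U x) e).symm
  simp_rw [mul_comm (U _), mul_sub, sub_mul]
  rw [integral_sub integrable_left integrable_mul, integral_sub integrable_mul integrable_right,
    shift, neg_sub]

section Increments

variable [MeasurableSpace E] [BorelSpace E] {μ : Measure E} {U V φ : E → ℝ}

theorem tendsto_integral_mul_increment_div (hU : Integrable U μ) (hφ : ContDiff ℝ ∞ φ)
    (hc : HasCompactSupport φ) (θ : E) :
    Tendsto (fun t : ℝ => ∫ x, U x * ((φ x - φ (x - t • θ)) / t) ∂μ) (𝓝[>] 0)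
      (𝓝 (∫ x, U x * fderiv ℝ φ x θ ∂μ)) := by
  obtain ⟨K, hK⟩ := hφ.lipschitzWith_of_hasCompactSupport hc (by simp)
  refine tendsto_integral_filter_of_dominated_convergence (fun x => ‖U x‖ * (K * ‖θ‖))
    (.of_forall fun t => ?_) ?_ (hU.norm.mul_const _) (.of_forall fun x => ?_)
  · have quotient_continuous : Continuous fun x => (φ x - φ (x - t • θ)) / t :=
      (hφ.continuous.sub (hφ.continuous.comp (continuous_sub_right _))).div_const t
    exact hU.1.mul quotient_continuous.aestronglyMeasurable
  · filter_upwards [self_mem_nhdsWithin] with t ht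
    refine .of_forall fun x => ?_
    rw [norm_mul, norm_div, Real.norm_of_nonneg (mem_Ioi.1 ht).le]
    gcongr
    rw [div_le_iff₀ ht]
    simpa [norm_smul, abs_of_pos (mem_Ioi.1 ht), mul_assoc, mul_comm t] using
      hK.norm_sub_le x (x - t • θ)
  · have diff := (hφ.differentiable (by simp) x).hasFDerivAt.hasLineDerivAt (-θ)
    refine Tendsto.const_mul (U x) ?_
    simpa [div_eq_inv_mul, ← sub_eq_add_neg, ← mul_neg] using diff.tendsto_slope_zero_right.neg

theorem tendsto_integral_mul_segmentAverage (hV : Integrable V μ) (hφ : ContDiff ℝ ∞ φ)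
    (hc : HasCompactSupport φ) (θ : E) :
    Tendsto (fun t : ℝ => ∫ x, V x * segmentAverage φ (t • θ) x ∂μ) (𝓝 0)
      (𝓝 (∫ x, V x * φ x ∂μ)) := by
  obtain ⟨C, hC⟩ := hc.exists_bound_of_continuous hφ.continuous
  refine tendsto_integral_filter_of_dominated_convergence (fun x => ‖V x‖ * C)
    (.of_forall fun t => hV.1.mul
      (contDiff_segmentAverage hφ hc (t • θ)).continuous.aestronglyMeasurable)
    (.of_forall fun t => .of_forall fun x => ?_) (hV.norm.mul_const C)
    (.of_forall fun x => (tendsto_segmentAverage hφ.continuous θ x).const_mul (V x))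
  rw [norm_mul]
  gcongr
  exact abs_segmentAverage_le hC _ x

variable [SecondCountableTopology E] [SFinite μ] [μ.IsAddRightInvariant] {C : ℝ}

theorem integral_mul_intervalIntegral_comp_add_smul (hV : Integrable V μ) (hφ : Continuous φ)
    (hC : ∀ x, ‖φ x‖ ≤ C) (e : E) :
    ∫ x, φ x * (∫ s in (0 : ℝ)..1, V (x + s • e)) ∂μ = ∫ x, V x * segmentAverage φ e x ∂μ := by
  let ν : Measure ℝ := volume.restrict (Ioc 0 1)
  have integrable_left : Integrable (fun p : E × ℝ => φ p.1 * V (p.1 + p.2 • e)) (μ.prod ν) :=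
    (integrable_comp_add_smul hV e ν).bdd_mul
      (hφ.comp continuous_fst).aestronglyMeasurable (.of_forall fun p => hC p.1)
  have integrable_right : Integrable (fun p : E × ℝ => V p.1 * φ (p.1 - p.2 • e)) (μ.prod ν) :=
    (hV.comp_fst ν).mul_bdd
      (by fun_prop : Continuous fun p : E × ℝ => φ (p.1 - p.2 • e)).aestronglyMeasurable
      (.of_forall fun p => hC _)
  simp_rw [segmentAverage, intervalIntegral.integral_of_le zero_le_one, ← integral_const_mul]
  rw [integral_integral_swap (f := fun x s => φ x * V (x + s • e)) integrable_left,
    integral_integral_swap (f := fun x s => V x * φ (x - s • e)) integrable_right]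
  refine integral_congr_ae (.of_forall fun s => ?_)
  simpa [mul_comm] using integral_add_right_eq_self (fun x => V x * φ (x - s • e)) (s • e)

/-- Testing the increment of `U` against `φ` amounts to testing `U` against the increment of
`φ`, which is the derivative of `segmentAverage φ`. -/
theorem integral_mul_increment (hU : Integrable U μ) (hV : Integrable V μ) (hφ : Continuous φ)
    (hC : ∀ x, ‖φ x‖ ≤ C) (θ : E) (t : ℝ) :
    ∫ x, φ x * (U (x + t • θ) - U x - ∫ r in (0 : ℝ)..t, V (x + r • θ)) ∂μ =
      -(∫ x, U x * (φ x - φ (x - t • θ)) ∂μ + t * ∫ x, V x * segmentAverage φ (t • θ) x ∂μ) := by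
  have rescale (x : E) : ∫ r in (0 : ℝ)..t, V (x + r • θ) =
      t * ∫ s in (0 : ℝ)..1, V (x + s • t • θ) := by
    simpa [smul_smul] using (intervalIntegral.mul_integral_comp_mul_right (a := 0) (b := 1)
      (f := fun r => V (x + r • θ)) (c := t)).symm
  have integrable_mul {f : E → ℝ} (hf : Integrable f μ) : Integrable (fun x => φ x * f x) μ :=
    hf.bdd_mul hφ.aestronglyMeasurable (.of_forall hC)
  have segment_integrable :=
    (integrable_intervalIntegral_comp_add_smul hV (t • θ) zero_le_one).const_mul t
  simp_rw [rescale, mul_sub (φ _) (U _ - U _)]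
  rw [integral_sub
      (integrable_mul (f := fun x => U (x + t • θ) - U x) ((hU.comp_add_right _).sub hU))
      (integrable_mul segment_integrable), integral_mul_add_sub hU hφ.measurable hC]
  simp_rw [mul_left_comm (φ _) t, integral_const_mul]
  rw [integral_mul_intervalIntegral_comp_add_smul hV hφ hC, neg_add, sub_eq_add_neg]

end Increments

variable [FiniteDimensional ℝ E] [MeasureSpace E] [BorelSpace E]
  [(volume : Measure E).IsAddHaarMeasure] {Ω : Set E} {θ : E} {U V : E → ℝ}

/-- Test the weak derivative with the segment averages of test functions supported in the open
set of those `x` for which the whole segment `[x, x + t θ]` lies in `Ω`. -/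
theorem HasWeakDirDeriv.ae_add_smul_sub_eq (hw : HasWeakDirDeriv Ω θ U V) (hΩ : IsOpen Ω)
    (hU : Integrable U) (hV : Integrable V) {t : ℝ} (ht : 0 ≤ t) :
    ∀ᵐ x, (∀ s ∈ Icc 0 t, x + s • θ ∈ Ω) →
      U (x + t • θ) - U x = ∫ r in (0 : ℝ)..t, V (x + r • θ) := by
  have increment_integrable : Integrable
      fun x => U (x + t • θ) - U x - ∫ r in (0 : ℝ)..t, V (x + r • θ) :=
    ((hU.comp_add_right _).sub hU).sub (integrable_intervalIntegral_comp_add_smul hV θ ht)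
  suffices increment_eq_zero : ∀ᵐ x, (∀ s ∈ Icc 0 t, x + s • θ ∈ Ω) →
      U (x + t • θ) - U x - ∫ r in (0 : ℝ)..t, V (x + r • θ) = 0 by
    filter_upwards [increment_eq_zero] with x hx hseg using sub_eq_zero.1 (hx hseg)
  refine (isOpen_setOf_forall_add_smul_mem hΩ θ
    isCompact_Icc).ae_eq_zero_of_integral_contDiff_smul_eq_zero
      (increment_integrable.locallyIntegrable.locallyIntegrableOn _) fun φ hφ hc hsupp => ?_
  obtain ⟨C, hC⟩ := hc.exists_bound_of_continuous hφ.continuous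
  have tsupport_subset : tsupport (segmentAverage φ (t • θ)) ⊆ Ω := by
    refine (tsupport_segmentAverage_subset hc _).trans ?_
    rintro _ ⟨⟨x, s⟩, ⟨hx, hs⟩, rfl⟩
    simpa [smul_smul] using hsupp hx (s * t)
      ⟨mul_nonneg hs.1 ht, mul_le_of_le_one_left ht hs.2⟩
  have weak := hasWeakDirDeriv_iff.1 hw _ (contDiff_segmentAverage hφ hc (t • θ))
    (hasCompactSupport_segmentAverage hc _) tsupport_subset
  have fderiv_eq (x : E) :
      φ x - φ (x - t • θ) = t * fderiv ℝ (segmentAverage φ (t • θ)) x θ := by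
    have diff := (contDiff_segmentAverage hφ hc (t • θ)).differentiable (by simp) x
    rw [← smul_eq_mul, ← map_smul, ← diff.lineDeriv_eq_fderiv,
      (hasLineDerivAt_segmentAverage hφ.continuous _ x).lineDeriv]
  simp_rw [smul_eq_mul, integral_mul_increment hU hV hφ.continuous hC, fderiv_eq,
    mul_left_comm _ t, integral_const_mul, weak]
  ring

/-- Arbitrarily small increments suffice because the difference quotients of a test function
converge to its directional derivative. -/
theorem hasWeakDirDeriv_of_frequently (hΩ : IsOpen Ω) (hU : Integrable U) (hV : Integrable V)
    (hincr : ∃ᶠ t in 𝓝[>] (0 : ℝ), ∀ᵐ x, (∀ s ∈ Icc 0 t, x + s • θ ∈ Ω) →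
      U (x + t • θ) - U x = ∫ r in (0 : ℝ)..t, V (x + r • θ)) :
    HasWeakDirDeriv Ω θ U V := by
  refine hasWeakDirDeriv_iff.2 fun φ hφ hc hsupp => ?_
  obtain ⟨C, hC⟩ := hc.exists_bound_of_continuous hφ.continuous
  refine tendsto_nhds_unique_of_frequently_eq (tendsto_integral_mul_increment_div hU hφ hc θ)
    ((tendsto_integral_mul_segmentAverage hV hφ hc θ).neg.mono_left nhdsWithin_le_nhds) ?_
  refine (hincr.and_eventually ((eventually_forall_add_smul_mem hc.isCompact hΩ hsupp θ).and
    self_mem_nhdsWithin)).mono fun t ⟨increment, segment_mem, ht⟩ => ?_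
  have tested_increment :
      ∫ x, φ x * (U (x + t • θ) - U x - ∫ r in (0 : ℝ)..t, V (x + r • θ)) = 0 := by
    refine integral_eq_zero_of_ae (increment.mono fun x hx => ?_)
    by_cases hxφ : x ∈ tsupport φ
    · simp [hx (segment_mem x hxφ)]
    · simp [image_eq_zero_of_notMem_tsupport hxφ]
  rw [integral_mul_increment hU hV hφ.continuous hC] at tested_increment
  simp_rw [← mul_div_assoc, integral_div]
  rw [div_eq_iff (mem_Ioi.1 ht).ne']
  linarith

end WeakDerivative

section Exit

variable {d : ℕ} {Ω : Set (EuclideanSpace ℝ (Fin d))} {θ x : EuclideanSpace ℝ (Fin d)} {t : ℝ}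

theorem delta_nonneg (Ω : Set (EuclideanSpace ℝ (Fin d))) (θ x : EuclideanSpace ℝ (Fin d)) :
    0 ≤ delta Ω θ x :=
  Real.sSup_nonneg fun _ hs => hs.1

theorem add_smul_mem (hΩ : IsOpen Ω) (hb : Bornology.IsBounded Ω) (hθ : ‖θ‖ = 1)
    (ht : t ∈ Ico 0 (delta Ω θ x)) : x + t • θ ∈ Ω :=
  (lt_delta_iff hΩ hb hθ x ht.1).1 ht.2 t ⟨ht.1, le_rfl⟩

theorem delta_pos (hΩ : IsOpen Ω) (hb : Bornology.IsBounded Ω) (hθ : ‖θ‖ = 1) (hx : x ∈ Ω) :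
    0 < delta Ω θ x :=
  (lt_delta_iff hΩ hb hθ x le_rfl).2 fun t ht => by simpa [le_antisymm ht.2 ht.1] using hx

theorem delta_le_diam (hΩ : IsOpen Ω) (hb : Bornology.IsBounded Ω) (hθ : ‖θ‖ = 1) :
    delta Ω θ x ≤ Metric.diam Ω := by
  refine le_of_forall_lt_imp_le_of_dense fun c hc => ?_
  obtain hneg | hc0 := lt_or_ge c 0
  · exact hneg.le.trans Metric.diam_nonneg
  have endpoints_mem := (lt_delta_iff hΩ hb hθ x hc0).1 hc
  simpa [norm_smul, hθ, abs_of_nonneg hc0] using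
    Metric.dist_le_diam_of_mem hb (endpoints_mem c ⟨hc0, le_rfl⟩) (endpoints_mem 0 ⟨le_rfl, hc0⟩)

theorem delta_eq_of_forall_mem (hΩ : IsOpen Ω) (hb : Bornology.IsBounded Ω) (hθ : ‖θ‖ = 1)
    (ht : 0 ≤ t) (hmem : ∀ s ∈ Ico 0 t, x + s • θ ∈ Ω) (hnot : x + t • θ ∉ Ω) :
    delta Ω θ x = t := by
  refine le_antisymm (not_lt.1 fun hlt => hnot (add_smul_mem hΩ hb hθ ⟨ht, hlt⟩)) ?_
  refine not_lt.1 fun hlt => lt_irrefl (delta Ω θ x) ?_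
  exact (lt_delta_iff hΩ hb hθ x (delta_nonneg Ω θ x)).2 fun s hs =>
    hmem s ⟨hs.1, hs.2.trans_lt hlt⟩

theorem Phi_notMem (hΩ : IsOpen Ω) (hb : Bornology.IsBounded Ω) (hθ : ‖θ‖ = 1) :
    Phi Ω θ x ∉ Ω := fun hmem => by
  refine lt_irrefl (delta Ω θ x)
    ((lt_delta_iff hΩ hb hθ x (delta_nonneg Ω θ x)).2 fun t ht => ?_)
  obtain hlt | rfl := ht.2.lt_or_eq
  exacts [add_smul_mem hΩ hb hθ ⟨ht.1, hlt⟩, hmem]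

theorem delta_add_smul (hΩ : IsOpen Ω) (hb : Bornology.IsBounded Ω) (hθ : ‖θ‖ = 1)
    (ht : t ∈ Icc 0 (delta Ω θ x)) : delta Ω θ (x + t • θ) = delta Ω θ x - t := by
  refine delta_eq_of_forall_mem hΩ hb hθ (sub_nonneg.2 ht.2) (fun s hs => ?_) ?_
  · rw [add_assoc, ← add_smul]
    exact add_smul_mem hΩ hb hθ ⟨add_nonneg ht.1 hs.1, by linarith [hs.2]⟩
  · rw [add_assoc, ← add_smul, add_sub_cancel]
    exact Phi_notMem hΩ hb hθ

theorem Phi_add_smul (hΩ : IsOpen Ω) (hb : Bornology.IsBounded Ω) (hθ : ‖θ‖ = 1)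
    (ht : t ∈ Icc 0 (delta Ω θ x)) : Phi Ω θ (x + t • θ) = Phi Ω θ x := by
  rw [Phi, delta_add_smul hΩ hb hθ ht, add_assoc, ← add_smul, add_sub_cancel, Phi]

theorem measurable_delta (hΩ : IsOpen Ω) (hb : Bornology.IsBounded Ω) (hθ : ‖θ‖ = 1) :
    Measurable (delta Ω θ) := by
  have delta_eq_inner : delta Ω θ = fun x => inner ℝ θ (Phi Ω θ x - x) := by
    ext x
    simp [Phi, inner_smul_right, hθ]
  rw [delta_eq_inner]
  exact ((measurable_Phi hΩ hb hθ).sub measurable_id).const_inner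

end Exit

section ZeroExtension

variable {d : ℕ} {Ω : Set (EuclideanSpace ℝ (Fin d))} {θ : EuclideanSpace ℝ (Fin d)}

/-- The extension by zero of `u ∈ L²(Ω)` to the whole space. It is an everywhere defined function,
built from the measurable representative of `u` chosen by Mathlib's coercion of `Lp` to
functions. -/
noncomputable def zeroExt (u : L2 Ω) : EuclideanSpace ℝ (Fin d) → ℝ :=
  Ω.indicator u

theorem stronglyMeasurable_zeroExt (hΩ : MeasurableSet Ω) (u : L2 Ω) :
    StronglyMeasurable (zeroExt u) :=
  (Lp.stronglyMeasurable u).indicator hΩ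

theorem memLp_zeroExt (hΩ : MeasurableSet Ω) (u : L2 Ω) : MemLp (zeroExt u) 2 :=
  (memLp_indicator_iff_restrict hΩ).2 (Lp.memLp u)

theorem integrable_zeroExt (hΩ : MeasurableSet Ω) (hb : Bornology.IsBounded Ω) (u : L2 Ω) :
    Integrable (zeroExt u) := by
  have : IsFiniteMeasure (volume.restrict Ω) := isFiniteMeasure_restrict.2 hb.measure_lt_top.ne
  exact (integrable_indicator_iff hΩ).2 ((Lp.memLp u).integrable one_le_two)

theorem norm_sq_eq_integral {α : Type*} [MeasurableSpace α] {μ : Measure α} (u : Lp ℝ 2 μ) :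
    ‖u‖ ^ 2 = ∫ x, u x ^ 2 ∂μ := by
  rw [← real_inner_self_eq_norm_sq, L2.inner_def]
  simp [sq]

theorem integral_sq_zeroExt (hΩ : MeasurableSet Ω) (u : L2 Ω) :
    ∫ x, zeroExt u x ^ 2 = ‖u‖ ^ 2 := by
  rw [norm_sq_eq_integral, ← integral_indicator hΩ]
  congr with x
  by_cases hx : x ∈ Ω <;> simp [zeroExt, hx]

theorem hasWeakDirDeriv_zeroExt (hΩ : MeasurableSet Ω) {u v : L2 Ω}
    (hw : HasWeakDirDeriv Ω θ u v) : HasWeakDirDeriv Ω θ (zeroExt u) (zeroExt v) := by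
  intro φ hφ hc hsupp
  have integral_eq (f : L2 Ω) (ψ : EuclideanSpace ℝ (Fin d) → ℝ) :
      ∫ x in Ω, zeroExt f x * ψ x = ∫ x in Ω, f x * ψ x :=
    setIntegral_congr_fun hΩ fun x hx => by simp [zeroExt, hx]
  rw [integral_eq, integral_eq, hw φ hφ hc hsupp]

end ZeroExtension

section EndValue

variable {E : Type*} [NormedAddCommGroup E] [NormedSpace ℝ E]

/-- The limit of the averages of `U` over the segments `[z - θ / (n + 1), z]`: the value which `U`
takes at `z` when `z` is reached in the direction `θ`. The upper limit makes it an everywhere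
defined Borel function of `z`. -/
noncomputable def endValue (θ : E) (U : E → ℝ) (z : E) : ℝ :=
  limsup (fun n : ℕ => ⨍ s in (0 : ℝ)..1 / (n + 1), U (z - s • θ)) atTop

theorem measurable_endValue [MeasurableSpace E] [BorelSpace E] [SecondCountableTopology E] (θ : E)
    {U : E → ℝ} (hU : Measurable U) : Measurable (endValue θ U) := by
  refine Measurable.limsup fun n => ?_
  have integrand : StronglyMeasurable fun p : E × ℝ => U (p.1 - p.2 • θ) :=
    (hU.comp (by fun_prop)).stronglyMeasurable
  simp_rw [interval_average_eq_div, intervalIntegral.integral_of_le Nat.one_div_pos_of_nat.le]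
  exact integrand.integral_prod_right'.measurable.div_const _

theorem tendsto_one_div_add_one_nhdsGT_zero :
    Tendsto (fun n : ℕ => 1 / ((n : ℝ) + 1)) atTop (𝓝[>] 0) :=
  tendsto_nhdsWithin_iff.2 ⟨tendsto_one_div_add_atTop_nhds_zero_nat,
    .of_forall fun _ => mem_Ioi.2 Nat.one_div_pos_of_nat⟩

theorem endValue_eq_of_ae {θ z : E} {U : E → ℝ} {F : ℝ → ℝ} (hF : Continuous F) {c : ℝ}
    (hc : 0 < c) (hU : ∀ᵐ s : ℝ, s ∈ Ioo 0 c → U (z - s • θ) = F s) : endValue θ U z = F 0 := by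
  have average_tendsto : Tendsto (fun h : ℝ => ⨍ s in (0 : ℝ)..h, F s) (𝓝[>] 0) (𝓝 (F 0)) := by
    simpa [interval_average_eq] using
      (hF.integral_hasStrictDerivAt 0 0).hasDerivAt.tendsto_slope_zero_right
  have average_eq : ∀ᶠ h in 𝓝[>] (0 : ℝ),
      ⨍ s in (0 : ℝ)..h, F s = ⨍ s in (0 : ℝ)..h, U (z - s • θ) := by
    filter_upwards [Ioo_mem_nhdsGT hc] with h hh
    rw [interval_average_eq, interval_average_eq]
    congr 1
    refine intervalIntegral.integral_congr_ae (hU.mono fun s hs hsh => (hs ?_).symm)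
    rw [uIoc_of_le hh.1.le] at hsh
    exact ⟨hsh.1, hsh.2.trans_lt hh.2⟩
  exact ((average_tendsto.congr' average_eq).comp tendsto_one_div_add_one_nhdsGT_zero).limsup_eq

end EndValue

section ExitIntegral

variable {d : ℕ} {Ω : Set (EuclideanSpace ℝ (Fin d))} {θ : EuclideanSpace ℝ (Fin d)} {u v : L2 Ω}

/-- The integral of `V` along the segment from `x` to the exit point `Φ_θ(x)`. -/
noncomputable def exitIntegral (Ω : Set (EuclideanSpace ℝ (Fin d)))
    (θ : EuclideanSpace ℝ (Fin d)) (V : EuclideanSpace ℝ (Fin d) → ℝ)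
    (x : EuclideanSpace ℝ (Fin d)) : ℝ :=
  ∫ r in (0 : ℝ)..delta Ω θ x, V (x + r • θ)

theorem measurable_exitIntegral (hΩ : IsOpen Ω) (hb : Bornology.IsBounded Ω) (hθ : ‖θ‖ = 1)
    {V : EuclideanSpace ℝ (Fin d) → ℝ} (hV : StronglyMeasurable V) :
    Measurable (exitIntegral Ω θ V) :=
  (stronglyMeasurable_intervalIntegral_comp_add_smul hV θ).measurable.comp
    (measurable_id.prodMk (measurable_delta hΩ hb hθ))

theorem ae_ae_add_smul_eq_add_intervalIntegral (hΩ : IsOpen Ω) (hb : Bornology.IsBounded Ω)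
    (hθ : ‖θ‖ = 1) (hw : HasWeakDirDeriv Ω θ u v) :
    ∀ᵐ x, ∀ᵐ t : ℝ, t ∈ Ico 0 (delta Ω θ x) →
      zeroExt u (x + t • θ) = zeroExt u x + ∫ r in (0 : ℝ)..t, zeroExt v (x + r • θ) := by
  have hum := (stronglyMeasurable_zeroExt hΩ.measurableSet u).measurable
  have hvm := stronglyMeasurable_zeroExt hΩ.measurableSet v
  have hδ := measurable_delta hΩ hb hθ
  have exceptional_measurable : MeasurableSet {p : EuclideanSpace ℝ (Fin d) × ℝ |
      p.2 ∈ Ico 0 (delta Ω θ p.1) → zeroExt u (p.1 + p.2 • θ) =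
        zeroExt u p.1 + ∫ r in (0 : ℝ)..p.2, zeroExt v (p.1 + r • θ)} :=
    ((measurableSet_le measurable_const measurable_snd).inter
      (measurableSet_lt measurable_snd (hδ.comp measurable_fst))).imp <|
      measurableSet_eq_fun (hum.comp (by fun_prop)) <| (hum.comp measurable_fst).add
        (stronglyMeasurable_intervalIntegral_comp_add_smul hvm θ).measurable
  refine (Measure.ae_ae_comm exceptional_measurable).2 (.of_forall fun t => ?_)
  obtain hneg | ht := lt_or_ge t 0
  · exact .of_forall fun x hx => absurd hx.1 hneg.not_ge
  filter_upwards [(hasWeakDirDeriv_zeroExt hΩ.measurableSet hw).ae_add_smul_sub_eq hΩ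
    (integrable_zeroExt hΩ.measurableSet hb u) (integrable_zeroExt hΩ.measurableSet hb v) ht]
    with x hx hxt
  exact (sub_eq_iff_eq_add'.1 (hx ((lt_delta_iff hΩ hb hθ x ht).1 hxt.2)))

theorem ae_eq_endValue_Phi_sub_exitIntegral (hΩ : IsOpen Ω) (hb : Bornology.IsBounded Ω)
    (hθ : ‖θ‖ = 1) (hw : HasWeakDirDeriv Ω θ u v) :
    ∀ᵐ x, x ∈ Ω →
      zeroExt u x = endValue θ (zeroExt u) (Phi Ω θ x) - exitIntegral Ω θ (zeroExt v) x := by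
  filter_upwards [ae_ae_add_smul_eq_add_intervalIntegral hΩ hb hθ hw,
    ae_intervalIntegrable_comp_add_smul (integrable_zeroExt hΩ.measurableSet hb v) θ]
    with x hx hint hxΩ
  have primitive_continuous : Continuous fun t : ℝ =>
      zeroExt u x + ∫ r in (0 : ℝ)..t, zeroExt v (x + r • θ) :=
    continuous_const.add (intervalIntegral.continuous_primitive hint 0)
  have ae_eq_primitive : ∀ᵐ s : ℝ, s ∈ Ioo 0 (delta Ω θ x) → zeroExt u (Phi Ω θ x - s • θ) =
      zeroExt u x + ∫ r in (0 : ℝ)..delta Ω θ x - s, zeroExt v (x + r • θ) := by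
    filter_upwards [(Measure.measurePreserving_sub_left (volume : Measure ℝ)
      (delta Ω θ x)).quasiMeasurePreserving.ae hx] with s hs hsδ
    rw [← hs ⟨sub_nonneg.2 hsδ.2.le, sub_lt_self _ hsδ.1⟩, Phi, sub_smul, add_sub_assoc]
  rw [endValue_eq_of_ae (primitive_continuous.comp (continuous_sub_left _))
    (delta_pos hΩ hb hθ hxΩ) ae_eq_primitive, exitIntegral]
  simp

theorem sq_intervalIntegral_le {f : ℝ → ℝ} {a b : ℝ} (hab : a ≤ b)
    (hf : IntervalIntegrable f volume a b)
    (hf_sq : IntervalIntegrable (fun x => f x ^ 2) volume a b) :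
    (∫ x in a..b, f x) ^ 2 ≤ (b - a) * ∫ x in a..b, f x ^ 2 := by
  obtain rfl | hlt := hab.eq_or_lt
  · simp
  have jensen : (⨍ x in a..b, f x) ^ 2 ≤ ⨍ x in a..b, f x ^ 2 := by
    rw [uIoc_of_le hab]
    exact (even_two.convexOn_pow (𝕜 := ℝ)).map_set_average_le (by fun_prop) isClosed_univ
      (by simp [hlt]) (by simp) (by simp) hf.1 hf_sq.1
  rw [interval_average_eq_div, interval_average_eq_div, div_pow,
    div_le_div_iff₀ (by positivity [sub_pos.2 hlt]) (sub_pos.2 hlt)] at jensen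
  nlinarith [sub_pos.2 hlt]

theorem ae_sq_exitIntegral_le (hΩ : IsOpen Ω) (hb : Bornology.IsBounded Ω) (hθ : ‖θ‖ = 1)
    (v : L2 Ω) :
    ∀ᵐ x, exitIntegral Ω θ (zeroExt v) x ^ 2 ≤
      Metric.diam Ω * ∫ r in (0 : ℝ)..Metric.diam Ω, zeroExt v (x + r • θ) ^ 2 := by
  filter_upwards [
    ae_intervalIntegrable_comp_add_smul (integrable_zeroExt hΩ.measurableSet hb v) θ,
    ae_intervalIntegrable_comp_add_smul (memLp_zeroExt hΩ.measurableSet v).integrable_sq θ]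
    with x hint hint_sq
  have sq_nonneg_ae : ∀ s : Set ℝ, 0 ≤ᵐ[volume.restrict s] fun r => zeroExt v (x + r • θ) ^ 2 :=
    fun _ => .of_forall fun _ => sq_nonneg _
  calc exitIntegral Ω θ (zeroExt v) x ^ 2
    _ ≤ (delta Ω θ x - 0) * ∫ r in (0 : ℝ)..delta Ω θ x, zeroExt v (x + r • θ) ^ 2 :=
      sq_intervalIntegral_le (delta_nonneg Ω θ x) (hint _ _) (hint_sq _ _)
    _ ≤ Metric.diam Ω * ∫ r in (0 : ℝ)..Metric.diam Ω, zeroExt v (x + r • θ) ^ 2 := by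
      rw [sub_zero]
      gcongr
      · exact intervalIntegral.integral_nonneg (delta_nonneg Ω θ x) fun _ _ => sq_nonneg _
      · exact delta_le_diam hΩ hb hθ
      · exact intervalIntegral.integral_mono_interval le_rfl (delta_nonneg Ω θ x)
          (delta_le_diam hΩ hb hθ) (sq_nonneg_ae _) (hint_sq _ _)

theorem memLp_exitIntegral (hΩ : IsOpen Ω) (hb : Bornology.IsBounded Ω) (hθ : ‖θ‖ = 1)
    (v : L2 Ω) : MemLp (exitIntegral Ω θ (zeroExt v)) 2 := by
  have hm := (measurable_exitIntegral hΩ hb hθ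
    (stronglyMeasurable_zeroExt hΩ.measurableSet v)).aestronglyMeasurable (μ := volume)
  refine (memLp_two_iff_integrable_sq hm).2 ?_
  refine ((integrable_intervalIntegral_comp_add_smul
    (memLp_zeroExt hΩ.measurableSet v).integrable_sq θ
    (Metric.diam_nonneg (s := Ω))).const_mul (Metric.diam Ω)).mono'
    (hm.pow 2) ?_
  filter_upwards [ae_sq_exitIntegral_le hΩ hb hθ v] with x hx
  rwa [Real.norm_of_nonneg (sq_nonneg _)]

theorem integral_sq_exitIntegral_le (hΩ : IsOpen Ω) (hb : Bornology.IsBounded Ω) (hθ : ‖θ‖ = 1)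
    (v : L2 Ω) : ∫ x in Ω, exitIntegral Ω θ (zeroExt v) x ^ 2 ≤ (Metric.diam Ω * ‖v‖) ^ 2 := by
  have hsq := (memLp_zeroExt hΩ.measurableSet v).integrable_sq
  calc ∫ x in Ω, exitIntegral Ω θ (zeroExt v) x ^ 2
    _ ≤ ∫ x, exitIntegral Ω θ (zeroExt v) x ^ 2 :=
      setIntegral_le_integral (memLp_exitIntegral hΩ hb hθ v).integrable_sq
        (.of_forall fun _ => sq_nonneg _)
    _ ≤ ∫ x, Metric.diam Ω * ∫ r in (0 : ℝ)..Metric.diam Ω, zeroExt v (x + r • θ) ^ 2 :=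
      integral_mono_ae (memLp_exitIntegral hΩ hb hθ v).integrable_sq
        ((integrable_intervalIntegral_comp_add_smul hsq θ Metric.diam_nonneg).const_mul _)
        (ae_sq_exitIntegral_le hΩ hb hθ v)
    _ = (Metric.diam Ω * ‖v‖) ^ 2 := by
      rw [integral_const_mul, integral_intervalIntegral_comp_add_smul hsq θ Metric.diam_nonneg,
        integral_sq_zeroExt hΩ.measurableSet, smul_eq_mul]
      ring

end ExitIntegral

section ExitTrace

variable {d : ℕ} {Ω : Set (EuclideanSpace ℝ (Fin d))} {θ : EuclideanSpace ℝ (Fin d)} {u v : L2 Ω}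

theorem ae_restrict_endValue_Phi_eq (hΩ : IsOpen Ω) (hb : Bornology.IsBounded Ω) (hθ : ‖θ‖ = 1)
    (hw : HasWeakDirDeriv Ω θ u v) :
    (fun x => endValue θ (zeroExt u) (Phi Ω θ x)) =ᵐ[volume.restrict Ω]
      zeroExt u + exitIntegral Ω θ (zeroExt v) := by
  refine (ae_restrict_iff' hΩ.measurableSet).2 ?_
  filter_upwards [ae_eq_endValue_Phi_sub_exitIntegral hΩ hb hθ hw] with x hx hxΩ
  rw [Pi.add_apply, hx hxΩ, sub_add_cancel]

theorem memLp_endValue_Phi (hΩ : IsOpen Ω) (hb : Bornology.IsBounded Ω) (hθ : ‖θ‖ = 1)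
    (hw : HasWeakDirDeriv Ω θ u v) :
    MemLp (fun x => endValue θ (zeroExt u) (Phi Ω θ x)) 2 (volume.restrict Ω) :=
  (memLp_congr_ae (ae_restrict_endValue_Phi_eq hΩ hb hθ hw)).2 <|
    ((memLp_zeroExt hΩ.measurableSet u).add (memLp_exitIntegral hΩ hb hθ v)).restrict Ω

theorem integral_sq_endValue_Phi_le (hΩ : IsOpen Ω) (hb : Bornology.IsBounded Ω) (hθ : ‖θ‖ = 1)
    (hw : HasWeakDirDeriv Ω θ u v) :
    ∫ x in Ω, endValue θ (zeroExt u) (Phi Ω θ x) ^ 2 ≤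
      2 * (‖u‖ ^ 2 + (Metric.diam Ω * ‖v‖) ^ 2) := by
  have hu_sq := (memLp_zeroExt hΩ.measurableSet u).integrable_sq
  have hI_sq := (memLp_exitIntegral hΩ hb hθ v).integrable_sq
  calc ∫ x in Ω, endValue θ (zeroExt u) (Phi Ω θ x) ^ 2
    _ ≤ ∫ x in Ω, 2 * (zeroExt u x ^ 2 + exitIntegral Ω θ (zeroExt v) x ^ 2) := by
      refine integral_mono_ae (memLp_endValue_Phi hΩ hb hθ hw).integrable_sq
        ((hu_sq.add hI_sq).const_mul 2).restrict ?_
      filter_upwards [ae_restrict_endValue_Phi_eq hΩ hb hθ hw] with x hx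
      rw [hx]
      exact add_sq_le
    _ = 2 * ((∫ x in Ω, zeroExt u x ^ 2) + ∫ x in Ω, exitIntegral Ω θ (zeroExt v) x ^ 2) := by
      rw [integral_const_mul, integral_add hu_sq.restrict hI_sq.restrict]
    _ ≤ 2 * (‖u‖ ^ 2 + (Metric.diam Ω * ‖v‖) ^ 2) := by
      gcongr
      · exact (setIntegral_le_integral hu_sq (.of_forall fun _ => sq_nonneg _)).trans_eq
          (integral_sq_zeroExt hΩ.measurableSet u)
      · exact integral_sq_exitIntegral_le hΩ hb hθ v

theorem norm_le_of_endValue_Phi_eq_zero (hΩ : IsOpen Ω) (hb : Bornology.IsBounded Ω)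
    (hθ : ‖θ‖ = 1) (hw : HasWeakDirDeriv Ω θ u v)
    (hzero : ∀ᵐ x ∂volume.restrict Ω, endValue θ (zeroExt u) (Phi Ω θ x) = 0) :
    ‖u‖ ≤ Metric.diam Ω * ‖v‖ := by
  refine le_of_sq_le_sq ?_ (by positivity)
  calc ‖u‖ ^ 2 = ∫ x in Ω, u x ^ 2 := norm_sq_eq_integral u
    _ = ∫ x in Ω, exitIntegral Ω θ (zeroExt v) x ^ 2 := by
      refine integral_congr_ae ?_
      filter_upwards [ae_restrict_endValue_Phi_eq hΩ hb hθ hw, hzero,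
        indicator_ae_eq_restrict hΩ.measurableSet (f := u)] with x hx hx0 hxu
      rw [← hxu, sq_eq_sq_iff_eq_or_eq_neg]
      exact .inr (eq_neg_of_add_eq_zero_left (hx.symm.trans hx0))
    _ ≤ (Metric.diam Ω * ‖v‖) ^ 2 := integral_sq_exitIntegral_le hΩ hb hθ v

end ExitTrace

section Lines

variable {d : ℕ} {Ω : Set (EuclideanSpace ℝ (Fin d))} {θ : EuclideanSpace ℝ (Fin d)}

/-- The parametrization `(y, s) ↦ s θ + y` of the space by `H_θ × ℝ`, which disintegrates Lebesgue
measure along the lines of direction `θ`. -/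
def lineMap (θ : EuclideanSpace ℝ (Fin d)) (p : Hyp θ × ℝ) : EuclideanSpace ℝ (Fin d) :=
  p.2 • θ + (p.1 : EuclideanSpace ℝ (Fin d))

theorem measurePreserving_lineMap (hθ : ‖θ‖ = 1) : MeasurePreserving (lineMap θ) := by
  have scale : MeasurePreserving
      (Prod.map (LinearIsometryEquiv.toSpanUnitSingleton (𝕜 := ℝ) θ hθ) (id : Hyp θ → Hyp θ)) :=
    (LinearIsometryEquiv.measurePreserving _).prod (.id _)
  have decompose := (Submodule.span ℝ {θ}).orthogonalDecomposition.symm.measurePreserving.comp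
    (WithLp.volume_preserving_toLp (Submodule.span ℝ {θ}) (Hyp θ))
  convert decompose.comp (scale.comp Measure.measurePreserving_swap)
  · simp [funext_iff, lineMap]
  · rfl

theorem ae_ae_line (hθ : ‖θ‖ = 1) {P : EuclideanSpace ℝ (Fin d) → Prop} (h : ∀ᵐ x, P x) :
    ∀ᵐ y : Hyp θ, ∀ᵐ s : ℝ, P (s • θ + (y : EuclideanSpace ℝ (Fin d))) :=
  Measure.ae_ae_of_ae_prod ((measurePreserving_lineMap hθ).quasiMeasurePreserving.ae h)

theorem ae_integrable_line (hθ : ‖θ‖ = 1) {F : Type*} [NormedAddCommGroup F]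
    {f : EuclideanSpace ℝ (Fin d) → F} (hf : Integrable f) :
    ∀ᵐ y : Hyp θ, Integrable fun s : ℝ => f (s • θ + (y : EuclideanSpace ℝ (Fin d))) :=
  (((measurePreserving_lineMap hθ).integrable_comp hf.1).2 hf).prod_right_ae

theorem ae_memLp_line (hθ : ‖θ‖ = 1) {f : EuclideanSpace ℝ (Fin d) → ℝ}
    (hfm : StronglyMeasurable f) (hf : MemLp f 2) :
    ∀ᵐ y : Hyp θ, MemLp (fun s : ℝ => f (s • θ + (y : EuclideanSpace ℝ (Fin d)))) 2 := by
  filter_upwards [ae_integrable_line hθ hf.integrable_sq] with y hy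
  exact (memLp_two_iff_integrable_sq
    (hfm.comp_measurable (by fun_prop)).aestronglyMeasurable).2 hy

theorem orthogonalProjectionOnto_lineMap (p : Hyp θ × ℝ) :
    (Hyp θ).orthogonalProjectionOnto (lineMap θ p) = p.1 := by
  rw [lineMap, map_add, Submodule.orthogonalProjectionOnto_mem_subspace_eq_self]
  simp

theorem exists_eq_smul_add_orthogonalProjectionOnto (θ x : EuclideanSpace ℝ (Fin d)) :
    ∃ s : ℝ, x = s • θ + ((Hyp θ).orthogonalProjectionOnto x : EuclideanSpace ℝ (Fin d)) := by
  have hmem := Submodule.sub_starProjection_mem_orthogonal (K := Hyp θ) x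
  rw [Submodule.orthogonal_orthogonal] at hmem
  obtain ⟨s, hs⟩ := Submodule.mem_span_singleton.1 hmem
  exact ⟨s, by rw [hs, Submodule.starProjection_apply, sub_add_cancel]⟩

theorem quasiMeasurePreserving_orthogonalProjectionOnto (hθ : ‖θ‖ = 1) :
    Measure.QuasiMeasurePreserving
      fun x : EuclideanSpace ℝ (Fin d) => (Hyp θ).orthogonalProjectionOnto x := by
  have hm : Measurable fun x : EuclideanSpace ℝ (Fin d) => (Hyp θ).orthogonalProjectionOnto x :=
    (Hyp θ).orthogonalProjectionOnto.continuous.measurable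
  refine ⟨hm, ?_⟩
  rw [← (measurePreserving_lineMap hθ).map_eq,
    Measure.map_map hm (measurePreserving_lineMap hθ).measurable,
    show _ ∘ lineMap θ = Prod.fst from funext orthogonalProjectionOnto_lineMap]
  exact Measure.quasiMeasurePreserving_fst.absolutelyContinuous

theorem isOpen_omega (hΩ : IsOpen Ω) (y : Hyp θ) : IsOpen (omega Ω θ y) :=
  hΩ.preimage (f := fun s : ℝ => s • θ + (y : EuclideanSpace ℝ (Fin d))) (by fun_prop)

/-- The one-dimensional weak derivative is recognised by its increments, and countably many
increments suffice: this is why a single null set of lines can be discarded. -/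
theorem ae_hasWeakDirDeriv_line (hΩ : IsOpen Ω) (hθ : ‖θ‖ = 1)
    {U V : EuclideanSpace ℝ (Fin d) → ℝ} (hU : Integrable U) (hV : Integrable V)
    (hw : HasWeakDirDeriv Ω θ U V) :
    ∀ᵐ y : Hyp θ, HasWeakDirDeriv (omega Ω θ y) (1 : ℝ)
      (fun s => U (s • θ + (y : EuclideanSpace ℝ (Fin d))))
      (fun s => V (s • θ + (y : EuclideanSpace ℝ (Fin d)))) := by
  have increments := ae_all_iff.2 fun n : ℕ =>
    ae_ae_line hθ (hw.ae_add_smul_sub_eq hΩ hU hV (Nat.one_div_pos_of_nat (n := n)).le)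
  filter_upwards [increments, ae_integrable_line hθ hU, ae_integrable_line hθ hV]
    with y hy hUy hVy
  refine hasWeakDirDeriv_of_frequently (isOpen_omega hΩ y) hUy hVy
    (tendsto_one_div_add_one_nhdsGT_zero.frequently (Frequently.of_forall fun n => ?_))
  filter_upwards [hy n] with s hs
  have shift (r : ℝ) : s • θ + (y : EuclideanSpace ℝ (Fin d)) + r • θ =
      (s + r • (1 : ℝ)) • θ + (y : EuclideanSpace ℝ (Fin d)) := by
    rw [smul_eq_mul, mul_one, add_smul, add_right_comm]
  simp only [shift] at hs
  exact hs

end Lines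

section Chords

variable {d : ℕ} {Ω : Set (EuclideanSpace ℝ (Fin d))} {θ : EuclideanSpace ℝ (Fin d)}
  {y : Hyp θ} {α β s : ℝ} {u v : L2 Ω}

theorem exists_isChord (hΩ : IsOpen Ω) (hb : Bornology.IsBounded Ω) (hθ : ‖θ‖ = 1)
    (hs : s ∈ omega Ω θ y) : ∃ α β, IsChord Ω θ y α β ∧ s ∈ Ioo α β := by
  set x := s • θ + (y : EuclideanSpace ℝ (Fin d)) with hx
  have hθ' : ‖-θ‖ = 1 := by rwa [norm_neg]
  have forward (t : ℝ) : s + t ∈ omega Ω θ y ↔ x + t • θ ∈ Ω := by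
    rw [hx, add_right_comm, ← add_smul]; rfl
  have backward (t : ℝ) : s - t ∈ omega Ω θ y ↔ x + t • -θ ∈ Ω := by
    rw [hx, add_right_comm, smul_neg, ← sub_eq_add_neg, ← sub_smul]; rfl
  have hβ : s < s + delta Ω θ x := lt_add_of_pos_right s (delta_pos hΩ hb hθ hs)
  have hα : s - delta Ω (-θ) x < s := sub_lt_self s (delta_pos hΩ hb hθ' hs)
  refine ⟨_, _, ⟨hα.trans hβ, fun t ht => ?_, (backward _).not.2 (Phi_notMem hΩ hb hθ'),
    (forward _).not.2 (Phi_notMem hΩ hb hθ)⟩, hα, hβ⟩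
  obtain hts | hst := le_total t s
  · rw [← sub_sub_cancel s t, backward]
    exact add_smul_mem hΩ hb hθ' ⟨sub_nonneg.2 hts, by linarith [ht.1]⟩
  · rw [← add_sub_cancel s t, forward]
    exact add_smul_mem hΩ hb hθ ⟨sub_nonneg.2 hst, by linarith [ht.2]⟩

theorem IsChord.delta_eq (hΩ : IsOpen Ω) (hb : Bornology.IsBounded Ω) (hθ : ‖θ‖ = 1)
    (h : IsChord Ω θ y α β) (hs : s ∈ Ioo α β) :
    delta Ω θ (s • θ + (y : EuclideanSpace ℝ (Fin d))) = β - s := by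
  have mem_omega_iff (t : ℝ) :
      s • θ + (y : EuclideanSpace ℝ (Fin d)) + t • θ ∈ Ω ↔ s + t ∈ omega Ω θ y := by
    rw [add_right_comm, ← add_smul]; rfl
  refine delta_eq_of_forall_mem hΩ hb hθ (sub_nonneg.2 hs.2.le) (fun t ht => ?_) ?_
  · exact (mem_omega_iff t).2 (h.2.1 ⟨by linarith [hs.1, ht.1], by linarith [ht.2]⟩)
  · rw [mem_omega_iff, add_sub_cancel]
    exact h.2.2.2

theorem IsChord.Phi_eq (hΩ : IsOpen Ω) (hb : Bornology.IsBounded Ω) (hθ : ‖θ‖ = 1)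
    (h : IsChord Ω θ y α β) (hs : s ∈ Ioo α β) :
    Phi Ω θ (s • θ + (y : EuclideanSpace ℝ (Fin d))) =
      β • θ + (y : EuclideanSpace ℝ (Fin d)) := by
  rw [Phi, h.delta_eq hΩ hb hθ hs, add_right_comm, ← add_smul, add_sub_cancel]

theorem IsChord.mem_frontier (hΩ : IsOpen Ω) (hb : Bornology.IsBounded Ω) (hθ : ‖θ‖ = 1)
    (h : IsChord Ω θ y α β) : β • θ + (y : EuclideanSpace ℝ (Fin d)) ∈ frontier Ω := by
  obtain ⟨s, hs⟩ := nonempty_Ioo.2 h.1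
  rw [← h.Phi_eq hΩ hb hθ hs]
  exact Phi_mem_frontier hΩ hb hθ (h.2.1 hs)

theorem IsChord.mem_proj (h : IsChord Ω θ y α β) : y ∈ proj Ω θ := by
  obtain ⟨s, hs⟩ := nonempty_Ioo.2 h.1
  exact ⟨_, h.2.1 hs, orthogonalProjectionOnto_lineMap (y, s)⟩

theorem IsChord.exitIntegral_eq (hΩ : IsOpen Ω) (hb : Bornology.IsBounded Ω) (hθ : ‖θ‖ = 1)
    (h : IsChord Ω θ y α β) (hs : s ∈ Ioo α β) (V : EuclideanSpace ℝ (Fin d) → ℝ) :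
    exitIntegral Ω θ V (s • θ + (y : EuclideanSpace ℝ (Fin d))) =
      ∫ r in s..β, V (r • θ + (y : EuclideanSpace ℝ (Fin d))) := by
  simpa only [exitIntegral, h.delta_eq hΩ hb hθ hs, add_zero, add_sub_cancel, add_smul,
    add_right_comm] using intervalIntegral.integral_comp_add_left
      (fun r => V (r • θ + (y : EuclideanSpace ℝ (Fin d)))) (a := 0) (b := β - s) s

theorem ae_exists_continuous_chord_representative (hΩ : IsOpen Ω) (hb : Bornology.IsBounded Ω)
    (hθ : ‖θ‖ = 1) (hw : HasWeakDirDeriv Ω θ u v) :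
    ∀ᵐ y : Hyp θ, ∀ α β, IsChord Ω θ y α β → ∃ f : ℝ → ℝ, Continuous f ∧
      (∀ᵐ s ∂volume.restrict (Ioo α β),
        f s = zeroExt u (s • θ + (y : EuclideanSpace ℝ (Fin d)))) ∧
      f β = endValue θ (zeroExt u) (β • θ + (y : EuclideanSpace ℝ (Fin d))) := by
  filter_upwards [ae_ae_line hθ (ae_eq_endValue_Phi_sub_exitIntegral hΩ hb hθ hw),
    ae_integrable_line hθ (integrable_zeroExt hΩ.measurableSet hb v)] with y hy hint α β hchord
  refine ⟨fun s => endValue θ (zeroExt u) (β • θ + (y : EuclideanSpace ℝ (Fin d))) -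
    ∫ r in s..β, zeroExt v (r • θ + (y : EuclideanSpace ℝ (Fin d))), ?_, ?_, by simp⟩
  · simp only [intervalIntegral.integral_symm β, sub_neg_eq_add]
    exact continuous_const.add
      (intervalIntegral.continuous_primitive (fun _ _ => hint.intervalIntegrable) β)
  · rw [ae_restrict_iff' measurableSet_Ioo]
    filter_upwards [hy] with s hs hmem
    rw [hs (hchord.2.1 hmem), hchord.Phi_eq hΩ hb hθ hmem, hchord.exitIntegral_eq hΩ hb hθ hmem]

end Chords

section DirMeasure

variable {d : ℕ} {Ω : Set (EuclideanSpace ℝ (Fin d))} {θ : EuclideanSpace ℝ (Fin d)} {u v : L2 Ω}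

theorem measurePreserving_val_dirMeasure (hΩ : IsOpen Ω) (hb : Bornology.IsBounded Ω)
    (hθ : ‖θ‖ = 1) :
    MeasurePreserving Subtype.val (dirMeasure Ω θ) ((volume.restrict Ω).map (Phi Ω θ)) := by
  have hF : MeasurableSet (frontier Ω) := isClosed_frontier.measurableSet
  refine ⟨measurable_subtype_coe, ?_⟩
  rw [dirMeasure, (MeasurableEmbedding.subtype_coe hF).map_comap, Subtype.range_coe]
  refine Measure.restrict_eq_self_of_ae_mem ?_
  refine (ae_map_iff (p := (· ∈ frontier Ω)) (measurable_Phi hΩ hb hθ).aemeasurable hF).2 ?_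
  filter_upwards [ae_restrict_mem hΩ.measurableSet] with x hx using Phi_mem_frontier hΩ hb hθ hx

theorem ae_restrict_of_ae_dirMeasure (hΩ : IsOpen Ω) (hb : Bornology.IsBounded Ω)
    (hθ : ‖θ‖ = 1) {P : frontier Ω → Prop} (hP : ∀ᵐ z ∂dirMeasure Ω θ, P z) :
    ∀ᵐ x ∂volume.restrict Ω, ∀ hz : Phi Ω θ x ∈ frontier Ω, P ⟨Phi Ω θ x, hz⟩ := by
  refine ae_of_ae_map (p := fun z => ∀ hz : z ∈ frontier Ω, P ⟨z, hz⟩)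
    (measurable_Phi hΩ hb hθ).aemeasurable ?_
  rw [← (measurePreserving_val_dirMeasure hΩ hb hθ).map_eq,
    (MeasurableEmbedding.subtype_coe isClosed_frontier.measurableSet).ae_map_iff]
  exact hP.mono fun z hz _ => hz

theorem ae_dirMeasure_orthogonalProjectionOnto (hΩ : IsOpen Ω) (hb : Bornology.IsBounded Ω)
    (hθ : ‖θ‖ = 1) {R : Hyp θ → Prop} (hR : ∀ᵐ y, R y) :
    ∀ᵐ z : frontier Ω ∂dirMeasure Ω θ,
      R ((Hyp θ).orthogonalProjectionOnto (z : EuclideanSpace ℝ (Fin d))) := by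
  have hproj := quasiMeasurePreserving_orthogonalProjectionOnto hθ
  have projection_comp_Phi : (fun x => (Hyp θ).orthogonalProjectionOnto x) ∘ Phi Ω θ =
      fun x => (Hyp θ).orthogonalProjectionOnto x := by
    ext1 x
    simp [Phi]
  have projection_exit : Measure.QuasiMeasurePreserving
      (fun z => (Hyp θ).orthogonalProjectionOnto z) ((volume.restrict Ω).map (Phi Ω θ)) := by
    refine ⟨hproj.measurable, ?_⟩
    rw [Measure.map_map hproj.measurable (measurable_Phi hΩ hb hθ), projection_comp_Phi]
    exact (hproj.mono_left Measure.restrict_le_self.absolutelyContinuous).absolutelyContinuous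
  exact (projection_exit.comp
    (measurePreserving_val_dirMeasure hΩ hb hθ).quasiMeasurePreserving).ae hR

theorem ae_dirMeasure_mem_image_Phi (hΩ : IsOpen Ω) (hb : Bornology.IsBounded Ω)
    (hθ : ‖θ‖ = 1) :
    ∀ᵐ z : frontier Ω ∂dirMeasure Ω θ, (z : EuclideanSpace ℝ (Fin d)) ∈ Phi Ω θ '' Ω := by
  have hΦ := measurable_Phi hΩ hb hθ
  -- `Φ_θ(Ω)` need not be Borel; stepping back from `z` by some `1 / (n + 1)` is a Borel condition.
  suffices step_back : ∀ᵐ z ∂(volume.restrict Ω).map (Phi Ω θ), ∃ n : ℕ,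
      z - (1 / ((n : ℝ) + 1)) • θ ∈ Ω ∧ Phi Ω θ (z - (1 / ((n : ℝ) + 1)) • θ) = z by
    filter_upwards [(measurePreserving_val_dirMeasure hΩ hb hθ).quasiMeasurePreserving.ae
      step_back] with z ⟨n, hmem, hexit⟩ using ⟨_, hmem, hexit⟩
  rw [ae_map_iff hΦ.aemeasurable]
  · filter_upwards [ae_restrict_mem hΩ.measurableSet] with x hx
    obtain ⟨n, hn⟩ := exists_nat_one_div_lt (delta_pos hΩ hb hθ hx)
    have hpos : 0 < 1 / ((n : ℝ) + 1) := Nat.one_div_pos_of_nat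
    have step_back_eq : Phi Ω θ x - (1 / ((n : ℝ) + 1)) • θ =
        x + (delta Ω θ x - 1 / ((n : ℝ) + 1)) • θ := by
      rw [Phi, add_sub_assoc, ← sub_smul]
    refine ⟨n, ?_⟩
    rw [step_back_eq]
    exact ⟨add_smul_mem hΩ hb hθ ⟨by linarith, by linarith⟩,
      Phi_add_smul hΩ hb hθ ⟨by linarith, by linarith⟩⟩
  · simp only [ofPred_exists]
    refine MeasurableSet.iUnion fun n => ?_
    have hm : Measurable fun z : EuclideanSpace ℝ (Fin d) => z - (1 / ((n : ℝ) + 1)) • θ :=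
      measurable_id.sub_const _
    exact (hm hΩ.measurableSet).inter (measurableSet_eq_fun (hΦ.comp hm) measurable_id)

theorem ae_dirMeasure_iff (hΩ : IsOpen Ω) (hb : Bornology.IsBounded Ω) (hθ : ‖θ‖ = 1)
    {P : frontier Ω → Prop} :
    (∀ᵐ z ∂dirMeasure Ω θ, P z) ↔ ∀ᵐ y : Hyp θ, ∀ α β, IsChord Ω θ y α β →
      ∀ hz : β • θ + (y : EuclideanSpace ℝ (Fin d)) ∈ frontier Ω, P ⟨_, hz⟩ := by
  constructor <;> intro hP
  · have on_lines := ae_ae_line hθ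
      ((ae_restrict_iff' hΩ.measurableSet).1 (ae_restrict_of_ae_dirMeasure hΩ hb hθ hP))
    filter_upwards [on_lines] with y hy α β hchord
    have : NeBot (ae (volume.restrict (Ioo α β))) := by
      simpa [ae_neBot, -ae_restrict_eq] using hchord.1
    obtain ⟨s, hPs, hs⟩ := ((ae_restrict_of_ae (s := Ioo α β) hy).and
      (ae_restrict_mem measurableSet_Ioo)).exists
    simpa only [hchord.Phi_eq hΩ hb hθ hs] using hPs (hchord.2.1 hs)
  · filter_upwards [ae_dirMeasure_orthogonalProjectionOnto hΩ hb hθ hP,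
      ae_dirMeasure_mem_image_Phi hΩ hb hθ] with ⟨z, hz⟩ hy hexit
    obtain ⟨x, hx, hxz⟩ : ∃ x ∈ Ω, Phi Ω θ x = z := hexit
    have projection_eq :
        (Hyp θ).orthogonalProjectionOnto z = (Hyp θ).orthogonalProjectionOnto x := by
      rw [← hxz, Phi]
      simp
    obtain ⟨s, hs⟩ := exists_eq_smul_add_orthogonalProjectionOnto θ x
    rw [hs] at hx
    obtain ⟨α, β, hchord, hsαβ⟩ := exists_isChord hΩ hb hθ hx
    have hzβ := hchord.Phi_eq hΩ hb hθ hsαβ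
    rw [← hs, hxz] at hzβ
    rw [projection_eq] at hy
    subst hzβ
    exact hy α β hchord hz

theorem memLp_endValue_dirMeasure (hΩ : IsOpen Ω) (hb : Bornology.IsBounded Ω) (hθ : ‖θ‖ = 1)
    (hw : HasWeakDirDeriv Ω θ u v) :
    MemLp (fun z : frontier Ω => endValue θ (zeroExt u) z) 2 (dirMeasure Ω θ) := by
  have hm := measurable_endValue θ (stronglyMeasurable_zeroExt hΩ.measurableSet u).measurable
  refine MemLp.comp_measurePreserving (g := endValue θ (zeroExt u)) ?_
    (measurePreserving_val_dirMeasure hΩ hb hθ)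
  exact (memLp_map_measure_iff hm.aestronglyMeasurable
    (measurable_Phi hΩ hb hθ).aemeasurable).2 (memLp_endValue_Phi hΩ hb hθ hw)

theorem integral_dirMeasure (hΩ : IsOpen Ω) (hb : Bornology.IsBounded Ω) (hθ : ‖θ‖ = 1)
    {f : EuclideanSpace ℝ (Fin d) → ℝ} (hf : StronglyMeasurable f) :
    ∫ z : frontier Ω, f z ∂dirMeasure Ω θ = ∫ x in Ω, f (Phi Ω θ x) := by
  rw [(measurePreserving_val_dirMeasure hΩ hb hθ).integral_comp
      (MeasurableEmbedding.subtype_coe isClosed_frontier.measurableSet),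
    integral_map (measurable_Phi hΩ hb hθ).aemeasurable hf.aestronglyMeasurable]

end DirMeasure

section DirectionalTrace

variable {d : ℕ} {Ω : Set (EuclideanSpace ℝ (Fin d))} {θ : EuclideanSpace ℝ (Fin d)}
  {u v : L2 Ω} {g : frontier Ω → ℝ}

theorem ae_memH1_line (hΩ : IsOpen Ω) (hb : Bornology.IsBounded Ω) (hθ : ‖θ‖ = 1)
    (hw : HasWeakDirDeriv Ω θ u v) :
    ∀ᵐ y : Hyp θ, MemH1 (omega Ω θ y)
      fun s => zeroExt u (s • θ + (y : EuclideanSpace ℝ (Fin d))) := by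
  have hm := hΩ.measurableSet
  filter_upwards [ae_memLp_line hθ (stronglyMeasurable_zeroExt hm u) (memLp_zeroExt hm u),
    ae_memLp_line hθ (stronglyMeasurable_zeroExt hm v) (memLp_zeroExt hm v),
    ae_hasWeakDirDeriv_line hΩ hθ (integrable_zeroExt hm hb u) (integrable_zeroExt hm hb v)
      (hasWeakDirDeriv_zeroExt hm hw)] with y hu hv hweak
  exact ⟨hu.restrict _, _, hv.restrict _, hweak⟩

theorem IsDirTrace.ae_eq_endValue (hg : IsDirTrace Ω θ u g) (hΩ : IsOpen Ω)
    (hb : Bornology.IsBounded Ω) (hθ : ‖θ‖ = 1) (hw : HasWeakDirDeriv Ω θ u v) :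
    g =ᵐ[dirMeasure Ω θ] fun z => endValue θ (zeroExt u) z := by
  obtain ⟨w, hwu, A, -, hA, trace_on_lines⟩ := hg
  have mem_A : ∀ᵐ y, y ∈ proj Ω θ → y ∈ A :=
    (measure_eq_zero_iff_ae_notMem.1 hA).mono fun y hy hproj => by_contra fun h => hy ⟨hproj, h⟩
  have representatives_eq : ∀ᵐ x, x ∈ Ω → w x = zeroExt u x :=
    (ae_restrict_iff' hΩ.measurableSet).1
      (hwu.trans (indicator_ae_eq_restrict hΩ.measurableSet).symm)
  refine (ae_dirMeasure_iff hΩ hb hθ).2 ?_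
  filter_upwards [mem_A, ae_ae_line hθ representatives_eq,
    ae_exists_continuous_chord_representative hΩ hb hθ hw] with y hyA hy hrep α β hchord hz
  obtain ⟨f, hf, hfw, _, hgf⟩ := (trace_on_lines y (hyA hchord.mem_proj)).2 α β hchord
  obtain ⟨F, hF, hFu, hFβ⟩ := hrep α β hchord
  have f_ae_eq : f =ᵐ[volume.restrict (Ioc α β)] F := by
    rw [← Measure.restrict_congr_set Ioo_ae_eq_Ioc]
    filter_upwards [hfw, hFu, ae_restrict_of_ae hy, ae_restrict_mem measurableSet_Ioo]
      with s hfs hFs hs hmem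
    rw [hfs, hFs, hs (hchord.2.1 hmem)]
  have f_eq : f β = F β :=
    Measure.eqOn_Ioc_of_ae_eq volume f_ae_eq hf hF.continuousOn (right_mem_Ioc.2 hchord.1)
  exact hgf.trans (f_eq.trans hFβ)

theorem isDirTrace_of_ae_eq_endValue (hΩ : IsOpen Ω) (hb : Bornology.IsBounded Ω) (hθ : ‖θ‖ = 1)
    (hw : HasWeakDirDeriv Ω θ u v)
    (hg : g =ᵐ[dirMeasure Ω θ] fun z => endValue θ (zeroExt u) z) : IsDirTrace Ω θ u g := by
  have good_lines := (ae_memH1_line hΩ hb hθ hw).and <|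
    (ae_exists_continuous_chord_representative hΩ hb hθ hw).and <|
      (ae_dirMeasure_iff hΩ hb hθ).1 hg
  refine ⟨zeroExt u, indicator_ae_eq_restrict hΩ.measurableSet, {y | y ∈ proj Ω θ ∧ _},
    fun y hy => hy.1, measure_mono_null (fun y hy hgood => hy.2 ⟨hy.1, hgood⟩) good_lines, ?_⟩
  rintro y ⟨-, hH1, hrep, hgy⟩
  refine ⟨hH1, fun α β hchord => ?_⟩
  obtain ⟨F, hF, hFu, hFβ⟩ := hrep α β hchord
  have hz := hchord.mem_frontier hΩ hb hθ
  exact ⟨F, hF.continuousOn, hFu, hz, (hgy α β hchord hz).trans hFβ.symm⟩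

theorem hasWeakDirDeriv_dirDeriv (hu : u ∈ W Ω θ) : HasWeakDirDeriv Ω θ u (dirDeriv Ω θ u) := by
  have hexists : ∃ v : L2 Ω, HasWeakDirDeriv Ω θ u v := hu
  rw [dirDeriv, dif_pos hexists]
  exact hexists.choose_spec

theorem integral_sq_endValue_dirMeasure_le (hΩ : IsOpen Ω) (hb : Bornology.IsBounded Ω)
    (hθ : ‖θ‖ = 1) (hu : u ∈ W Ω θ) :
    ∫ z : frontier Ω, endValue θ (zeroExt u) z ^ 2 ∂dirMeasure Ω θ ≤
      2 * max 1 (Metric.diam Ω ^ 2) * normW Ω θ u ^ 2 := by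
  have hm := measurable_endValue θ (stronglyMeasurable_zeroExt hΩ.measurableSet u).measurable
  calc ∫ z : frontier Ω, endValue θ (zeroExt u) z ^ 2 ∂dirMeasure Ω θ
    _ = ∫ x in Ω, endValue θ (zeroExt u) (Phi Ω θ x) ^ 2 :=
      integral_dirMeasure hΩ hb hθ (hm.pow_const 2).stronglyMeasurable
    _ ≤ 2 * (1 * ‖u‖ ^ 2 + Metric.diam Ω ^ 2 * ‖dirDeriv Ω θ u‖ ^ 2) := by
      simpa only [one_mul, mul_pow] using
        integral_sq_endValue_Phi_le hΩ hb hθ (hasWeakDirDeriv_dirDeriv hu)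
    _ ≤ 2 * (max 1 (Metric.diam Ω ^ 2) * ‖u‖ ^ 2 +
        max 1 (Metric.diam Ω ^ 2) * ‖dirDeriv Ω θ u‖ ^ 2) := by
      gcongr
      exacts [le_max_left _ _, le_max_right _ _]
    _ = 2 * max 1 (Metric.diam Ω ^ 2) * normW Ω θ u ^ 2 := by
      rw [normW, Real.sq_sqrt (by positivity)]
      ring

theorem norm_le_of_endValue_ae_eq_zero (hΩ : IsOpen Ω) (hb : Bornology.IsBounded Ω)
    (hθ : ‖θ‖ = 1) (hw : HasWeakDirDeriv Ω θ u v)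
    (hzero : ∀ᵐ z : frontier Ω ∂dirMeasure Ω θ, endValue θ (zeroExt u) z = 0) :
    ‖u‖ ≤ Metric.diam Ω * ‖v‖ := by
  refine norm_le_of_endValue_Phi_eq_zero hΩ hb hθ hw ?_
  filter_upwards [ae_restrict_of_ae_dirMeasure hΩ hb hθ hzero, ae_restrict_mem hΩ.measurableSet]
    with x hx hxΩ using hx (Phi_mem_frontier hΩ hb hθ hxΩ)

end DirectionalTrace

end DirTrace

theorem mainTheorem9 {d : ℕ} (Ω : Set (EuclideanSpace ℝ (Fin d))) (hΩ : IsOpen Ω)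
    (hb : Bornology.IsBounded Ω) (θ : EuclideanSpace ℝ (Fin d)) (hθ : ‖θ‖ = 1)
    (u : DirTrace.L2 Ω) (hu : u ∈ DirTrace.W Ω θ) :
    ∃ G : Lp ℝ 2 (DirTrace.dirMeasure Ω θ),
      DirTrace.dirTrace Ω θ u = {g | g =ᵐ[DirTrace.dirMeasure Ω θ] G} ∧
      ∫ z, (G z) ^ 2 ∂(DirTrace.dirMeasure Ω θ) ≤
        2 * max 1 (Metric.diam Ω ^ 2) * DirTrace.normW Ω θ u ^ 2 ∧
      (G = 0 → ‖u‖ ≤ Metric.diam Ω * ‖DirTrace.dirDeriv Ω θ u‖) := by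
  have hw := DirTrace.hasWeakDirDeriv_dirDeriv hu
  have hmem := DirTrace.memLp_endValue_dirMeasure hΩ hb hθ hw
  have hG := hmem.coeFn_toLp
  refine ⟨hmem.toLp, ?_, ?_, fun hzero => ?_⟩
  · ext g
    exact ⟨fun hg => (DirTrace.IsDirTrace.ae_eq_endValue hg hΩ hb hθ hw).trans hG.symm,
      fun hg => DirTrace.isDirTrace_of_ae_eq_endValue hΩ hb hθ hw (EventuallyEq.trans hg hG)⟩
  · exact (integral_congr_ae (hG.fun_comp (· ^ 2))).trans_le
      (DirTrace.integral_sq_endValue_dirMeasure_le hΩ hb hθ hu)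
  · exact DirTrace.norm_le_of_endValue_ae_eq_zero hΩ hb hθ hw
      (hG.symm.trans (Lp.eq_zero_iff_ae_eq_zero.1 hzero))
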